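/- Let $G=(V,E)$ be a finite simple undirected graph with $n$ vertices and no isolated vertices; write $d_i=\deg(i)$ and $\operatorname{vol}(S)=\sum_{i\in S}d_i$. Let $\mathrm{Sgn}(t)=\{1\}$ if $t>0$, $\mathrm{Sgn}(t)=\{-1\}$ if $t<0$, and $\mathrm{Sgn}(0)=[-1,1]$. For $x\in\mathbb{R}^V$ the signless $1$-Laplacian $\Delta_1^+x$ is the set of all vectors $\big(\sum_{j:\{i,j\}\in E}z_{ij}\big)_{i\in V}$ with $z_{ij}=z_{ji}\in\mathrm{Sgn}(x_i+x_j)$ for every edge $\{i,j\}$. A pair $(\lambda,x)$ with $\lambda\in\mathbb{R}$, $x\in\mathbb{R}^V\setminus\{0\}$, is an eigenpair of $\Delta_1^+$ if $\Delta_1^+x$ contains a vector of the form $(\lambda d_is_i)_{i\in V}$ with $s_i\in\mathrm{Sgn}(x_i)$ for all $i$. Let $I^+(x)=\sum_{\{i,j\}\in E}|x_i+x_j|$ and $X=\{x\in\mathbb{R}^V:\sum_{i\in V}d_i|x_i|=1\}$. For $1\le k\le n$ the $k$-th min-max eigenvalue is $$c_k=\inf_{A}\ \sup_{x\in A}I^+(x),$$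 where $A$ ranges over the compact sets $A\subseteq X$ with $A=-A$ and Krasnoselskii genus $\gamma(A)\ge k$; here $\gamma(A)$ is the least $m$ for which there is an odd continuous map $A\to\mathbb{R}^m\setminus\{0\}$. The $k$-way dual Cheeger constant is $$h_k^+=\max\ \min_{1\le i\le k}\frac{2|E(V_{2i-1},V_{2i})|}{\operatorname{vol}(V_{2i-1}\cup V_{2i})},$$ where the maximum is over all pairwise disjoint sets $V_1,\dots,V_{2k}\subseteq V$ with $V_{2i-1}\cup V_{2i}\neq\varnothing$ for every $i$, and $|E(A,B)|$ is the number of edges between $A$ and $B$. For $x\ne0$ let $S(x)$ be the number of connected components of the subgraph of $G$ induced on $\{i\in V:x_i\neq0\}$ (the nodal domains of $x$). Theorem. Let $1\le k\le n$ and suppose that $(c_k,x)$ is an eigenpair of $\Delta_1^+$. Then $$1-h^+_{S(x)}\le c_k\le 1-h^+_k .$$ -/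

import Mathlib

namespace DualCheeger

noncomputable section

/-- The set-valued sign: `{1}` for `t > 0`, `[-1, 1]` for `t = 0`, `{-1}` for `t < 0`. -/
def Sgn (t : ℝ) : Set ℝ :=
  if 0 < t then {1} else if t < 0 then {-1} else Set.Icc (-1) 1

/-- The Krasnoselskii genus of a set `A` (used for symmetric compact sets not containing `0`):
the least `m` such that there is an odd continuous map `A → ℝᵐ ∖ {0}`, and `⊤` if there is none.
The empty set has genus `0`. -/
def genus {V : Type*} (A : Set (V → ℝ)) : ℕ∞ :=
  ⨅ (m : ℕ) (_ : ∃ f : (V → ℝ) → (Fin m → ℝ),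
    ContinuousOn f A ∧ (∀ x ∈ A, f (-x) = -f x) ∧ ∀ x ∈ A, f x ≠ 0), (m : ℕ∞)

variable {V : Type*} [Fintype V] [DecidableEq V] (G : SimpleGraph V) [DecidableRel G.Adj]

/-- The value `Δ₁⁺ x ⊆ ℝ^V` of the signless 1-Laplacian (edge weights 1): the vectors
`(∑_{j ∼ i} z i j)_i` with `z i j = z j i ∈ Sgn (x i + x j)` for each edge `ij`. -/
def signlessLaplacian (x : V → ℝ) : Set (V → ℝ) :=
  {y | ∃ z : V → V → ℝ,
    (∀ i j, G.Adj i j → z i j ∈ Sgn (x i + x j) ∧ z i j = z j i) ∧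
    ∀ i, y i = ∑ j ∈ G.neighborFinset i, z i j}

/-- The set `D Sgn(x)` of the vectors `(deg(i) s_i)_i` with `s_i ∈ Sgn (x i)`. -/
def degSgn (x : V → ℝ) : Set (V → ℝ) :=
  {y | ∃ s : V → ℝ, (∀ i, s i ∈ Sgn (x i)) ∧ ∀ i, y i = (G.degree i : ℝ) * s i}

/-- `(c, x)` is an eigenpair of `Δ₁⁺`: `x ≠ 0` and `Δ₁⁺ x ∩ c D Sgn(x) ≠ ∅`. -/
def IsEigenpair (c : ℝ) (x : V → ℝ) : Prop :=
  x ≠ 0 ∧ (signlessLaplacian G x ∩ {y | ∃ s ∈ degSgn G x, y = c • s}).Nonempty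

/-- `I⁺(x) = ∑_{ij ∈ E} |x_i + x_j|`. -/
def Iplus (x : V → ℝ) : ℝ :=
  ∑ e ∈ G.edgeFinset, Sym2.lift ⟨fun i j => |x i + x j|, fun i j => congrArg _ (add_comm (x i) (x j))⟩ e

/-- `‖x‖ = ∑_i deg(i) |x_i|`. -/
def degNorm (x : V → ℝ) : ℝ :=
  ∑ i, (G.degree i : ℝ) * |x i|

/-- The unit sphere `X = {x : ‖x‖ = 1}`. -/
def unitSphere : Set (V → ℝ) :=
  {x | degNorm G x = 1}

/-- The `k`-th min-max eigenvalue of `Δ₁⁺`: the infimum of `sup_{x ∈ A} I⁺(x)` over the symmetric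
compact sets `A ⊆ X` of genus at least `k`. -/
def minmaxEigenvalue (k : ℕ) : ℝ :=
  sInf {r | ∃ A : Set (V → ℝ), A ⊆ unitSphere G ∧ IsCompact A ∧ (∀ x ∈ A, -x ∈ A) ∧
    (k : ℕ∞) ≤ genus A ∧ r = sSup (Iplus G '' A)}

/-- The volume of a vertex set: the sum of the degrees. -/
def vol (S : Finset V) : ℝ :=
  ∑ i ∈ S, (G.degree i : ℝ)

/-- The `k`-way dual Cheeger constant (for `1 ≤ k ≤ |V|`; the set of values below is then finite
and nonempty, and `sSup` is its maximum). The pairs `(A i, B i)` consist of pairwise disjoint sets,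
with `A i ∪ B i` nonempty; `G.interedges (A i) (B i)` has one element for each edge between the
disjoint sets `A i` and `B i`. -/
def kwayDualCheeger (k : ℕ) : ℝ :=
  sSup {r | ∃ A B : Fin k → Finset V,
    (∀ i, Disjoint (A i) (B i)) ∧
    (∀ i j, i ≠ j → Disjoint (A i ∪ B i) (A j ∪ B j)) ∧
    (∀ i, (A i ∪ B i).Nonempty) ∧
    r = ⨅ i, 2 * ((G.interedges (A i) (B i)).card : ℝ) / vol G (A i ∪ B i)}

/-- The number of nodal domains of `x`: the number of connected components of the subgraph induced
on the support of `x`. -/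
def numNodalDomains (x : V → ℝ) : ℕ :=
  Nat.card (G.induce {i | x i ≠ 0}).ConnectedComponent

end

end DualCheeger

/-!
The lower bound holds for every eigenpair `(c, x)`. On a nodal domain `D` of `x`, let `A` and `B` be
the parts where `x` is positive and negative. Multiply the eigenvalue equation at `v ∈ D` by the
sign of `x v` and sum over `D`. The right-hand side is `c * vol D`. On the left-hand side an edge
leaving `D` contributes `1`, because `x` vanishes at its other end, an edge inside `A` or inside `B`
contributes `2`, and an edge between `A` and `B` contributes `0`, because its two contributions
cancel. Hence `2 |E(A, B)| = (1 - c) vol D` (`two_mul_card_interedges_eq`): all nodal domains have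
the same ratio `1 - c`, and together they compete for the dual Cheeger constant.

For the upper bound, take `k` pairs `(A i, B i)` with ratios at least `r`. The combinations of the
functions `1_{A i} - 1_{B i}` in the unit sphere form the boundary of a `k`-dimensional
cross-polytope, and `I⁺ ≤ 1 - r` there (`Iplus_blockFun_le`), since the edges between `A i` and
`B i` do not contribute to `I⁺`. It remains to see that this set has genus at least `k`, which is
the Borsuk–Ulam theorem: an odd continuous map `f` from the sphere of dimension `n - 1` to `ℝᵐ` with
`m < n` has a zero (`exists_eq_zero_of_odd`).

The Borsuk–Ulam theorem is proved with simplicial chains modulo 2 whose simplices are lists of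
points. The hemispheres `h 0, h 1, …` of the cross-polytope satisfy `∂ h (i + 1) = h i + ν (h i)`,
where `ν` is the antipodal map, and barycentric subdivision preserves these relations while making
the simplices small. For each coordinate `j` of `f` let `a j` be the indicator of `f j > 0`, modified
where `f j = 0` so that `a j (-t) = a j t + 1`. By the relations between the hemispheres, the cup
product of the coboundaries of all `a j` takes the value `1` on `h m` (`IsHemispherical.ev_cup`). So
there is a simplex, as small as desired, on which every coordinate of `f` changes its sign, and a
nowhere vanishing `f` would contradict its uniform continuity.
-/

namespace DualCheeger

noncomputable section

/-! ### Chains of vertex lists -/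

/-- Simplicial chains modulo 2 whose simplices are lists of vertices (repetitions allowed). The
empty list is a simplex, so the complex is augmented. Chains of all degrees are kept in one
module. -/
abbrev ListChain (E : Type*) := List E →₀ ZMod 2

namespace ListChain

variable {E : Type*}

/-- The join of a chain with the vertex `v`. -/
def cone (v : E) : ListChain E →ₗ[ZMod 2] ListChain E :=
  Finsupp.lmapDomain _ _ (List.cons v)

/-- The boundary of one simplex: the sum of its faces. -/
def bdList : List E → ListChain E
  | [] => 0
  | v :: l => Finsupp.single l 1 + cone v (bdList l)

/-- The boundary operator. -/
def bd : ListChain E →ₗ[ZMod 2] ListChain E :=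
  Finsupp.linearCombination (ZMod 2) bdList

/-- The chain map induced by a map of the vertices. -/
def map (g : E → E) : ListChain E →ₗ[ZMod 2] ListChain E :=
  Finsupp.lmapDomain _ _ (List.map g)

@[simp] lemma cone_single (v : E) (l : List E) :
    cone v (Finsupp.single l 1) = Finsupp.single (v :: l) 1 := by
  simp [cone]

@[simp] lemma map_single (g : E → E) (l : List E) :
    map g (Finsupp.single l 1) = Finsupp.single (l.map g) 1 := by
  simp [map]

@[simp] lemma bd_single (l : List E) : bd (Finsupp.single l 1) = bdList l := by
  simp [bd]

lemma add_self (c : ListChain E) : c + c = 0 := by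
  ext l
  exact CharTwo.add_self_eq_zero (c l)

/-- Two linear maps that agree on the simplices of a set agree on the chains supported there. -/
lemma eq_of_supported {M : Type*} [AddCommGroup M] [Module (ZMod 2) M]
    {T U : ListChain E →ₗ[ZMod 2] M} {s : Set (List E)}
    (h : ∀ l ∈ s, T (Finsupp.single l 1) = U (Finsupp.single l 1)) {c : ListChain E}
    (hc : c ∈ Finsupp.supported (ZMod 2) (ZMod 2) s) : T c = U c := by
  rw [Finsupp.supported_eq_span_single] at hc
  refine LinearMap.eqOn_span (f := T) (g := U) ?_ hc
  rintro _ ⟨l, hl, rfl⟩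
  exact h l hl

lemma mem_of_supported {M : Type*} [AddCommGroup M] [Module (ZMod 2) M]
    {T : ListChain E →ₗ[ZMod 2] M} {s : Set (List E)} {p : Submodule (ZMod 2) M}
    (h : ∀ l ∈ s, T (Finsupp.single l 1) ∈ p) {c : ListChain E}
    (hc : c ∈ Finsupp.supported (ZMod 2) (ZMod 2) s) : T c ∈ p := by
  rw [Finsupp.supported_eq_span_single] at hc
  have : Submodule.span (ZMod 2) ((fun i => Finsupp.single i 1) '' s) ≤ p.comap T := by
    rw [Submodule.span_le]
    rintro _ ⟨l, hl, rfl⟩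
    exact h l hl
  exact this hc

lemma hom_ext {M : Type*} [AddCommGroup M] [Module (ZMod 2) M]
    {T U : ListChain E →ₗ[ZMod 2] M}
    (h : ∀ l, T (Finsupp.single l 1) = U (Finsupp.single l 1)) (c : ListChain E) : T c = U c :=
  eq_of_supported (s := Set.univ) (fun l _ => h l) (by simp)

lemma bd_cone (v : E) (c : ListChain E) : bd (cone v c) = c + cone v (bd c) := by
  refine hom_ext (T := bd ∘ₗ cone v) (U := LinearMap.id + cone v ∘ₗ bd) (fun l => ?_) c
  simp [bdList]

lemma bd_bdList (l : List E) : bd (bdList l) = 0 := by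
  induction l with
  | nil => simp [bdList]
  | cons v l ih => simp [bdList, bd_cone, ih, add_self]

lemma map_cone (g : E → E) (v : E) (c : ListChain E) :
    map g (cone v c) = cone (g v) (map g c) :=
  hom_ext (T := map g ∘ₗ cone v) (U := cone (g v) ∘ₗ map g) (fun l => by simp) c

lemma bdList_map (g : E → E) (l : List E) : bdList (l.map g) = map g (bdList l) := by
  induction l with
  | nil => simp [bdList]
  | cons v l ih => simp [bdList, map_cone, ih]

lemma bd_map (g : E → E) (c : ListChain E) : bd (map g c) = map g (bd c) :=
  hom_ext (T := bd ∘ₗ map g) (U := map g ∘ₗ bd) (fun l => by simp [bdList_map]) c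

lemma map_map_of_involutive {g : E → E} (hg : Function.Involutive g) (c : ListChain E) :
    map g (map g c) = c :=
  hom_ext (T := map g ∘ₗ map g) (U := LinearMap.id) (fun l => by simp [hg.comp_self]) c

lemma cone_mem_supported {v : E} {s t : Set (List E)} (h : ∀ l ∈ s, v :: l ∈ t)
    {c : ListChain E} (hc : c ∈ Finsupp.supported (ZMod 2) (ZMod 2) s) :
    cone v c ∈ Finsupp.supported (ZMod 2) (ZMod 2) t :=
  mem_of_supported (fun l hl => by
    rw [cone_single]; exact Finsupp.single_mem_supported _ _ (h l hl)) hc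

lemma map_mem_supported {g : E → E} {s t : Set (List E)} (h : ∀ l ∈ s, l.map g ∈ t)
    {c : ListChain E} (hc : c ∈ Finsupp.supported (ZMod 2) (ZMod 2) s) :
    map g c ∈ Finsupp.supported (ZMod 2) (ZMod 2) t :=
  mem_of_supported (fun l hl => by
    rw [map_single]; exact Finsupp.single_mem_supported _ _ (h l hl)) hc

lemma bdList_mem_supported (l : List E) :
    bdList l ∈ Finsupp.supported (ZMod 2) (ZMod 2)
      {l' | l'.Sublist l ∧ l'.length + 1 = l.length} := by
  induction l with
  | nil => simp [bdList]
  | cons v l ih =>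
    refine Submodule.add_mem _ (Finsupp.single_mem_supported _ _ ⟨by simp, by simp⟩) ?_
    exact cone_mem_supported (fun l' hl' => show _ ∧ _ from
      ⟨hl'.1.cons_cons v, congrArg Nat.succ hl'.2⟩) ih

/-! ### Barycentric subdivision -/

section Subdivision

variable [NormedAddCommGroup E] [NormedSpace ℝ E]

/-- The barycentre of the vertices of a simplex. -/
def bary (l : List E) : E := (l.length : ℝ)⁻¹ • l.sum

/-- Barycentric subdivision of the chains of simplices with `n` vertices: a simplex is replaced by
the cone, from its barycentre, over the subdivision of its boundary. The value on simplices with a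
different number of vertices is irrelevant. -/
def sd : ℕ → ListChain E →ₗ[ZMod 2] ListChain E
  | 0 => LinearMap.id
  | n + 1 => Finsupp.linearCombination (ZMod 2) fun l => cone (bary l) (sd n (bdList l))

@[simp] lemma sd_succ_single (n : ℕ) (l : List E) :
    sd (n + 1) (Finsupp.single l 1) = cone (bary l) (sd n (bdList l)) := by
  simp [sd]

@[simp] lemma sd_zero (c : ListChain E) : sd 0 c = c := rfl

attribute [irreducible] sd

lemma bary_map_neg (l : List E) : bary (l.map Neg.neg) = -bary l := by
  simp only [bary, List.length_map, ← smul_neg]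
  congr 1
  induction l with
  | nil => simp
  | cons v l ih => simp [ih, add_comm]

lemma sd_map_neg (n : ℕ) (c : ListChain E) : sd n (map Neg.neg c) = map Neg.neg (sd n c) := by
  induction n generalizing c with
  | zero => simp
  | succ n ih =>
    refine hom_ext (T := sd (n + 1) ∘ₗ map Neg.neg) (U := map Neg.neg ∘ₗ sd (n + 1))
      (fun l => ?_) c
    simp [bary_map_neg, bdList_map, ih, map_cone]

lemma bd_sd (n : ℕ) {c : ListChain E}
    (hc : c ∈ Finsupp.supported (ZMod 2) (ZMod 2) {l : List E | l.length = n + 1}) :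
    bd (sd (n + 1) c) = sd n (bd c) := by
  induction n generalizing c with
  | zero =>
    refine eq_of_supported (T := bd ∘ₗ sd 1) (U := sd 0 ∘ₗ bd) (fun l hl => ?_) hc
    obtain ⟨v, rfl⟩ := List.length_eq_one_iff.1 hl
    simp [bdList]
  | succ n ih =>
    rw [← LinearMap.comp_apply, ← LinearMap.comp_apply]
    refine eq_of_supported (fun l hl => ?_) hc
    have hl' : bdList l ∈ Finsupp.supported (ZMod 2) (ZMod 2) {l : List E | l.length = n + 1} := by
      refine Finsupp.supported_mono (fun l' h => ?_) (bdList_mem_supported l)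
      have h1 := h.2
      have h2 : l.length = n + 1 + 1 := hl
      simp only [Set.mem_ofPred_eq]; omega
    simp only [LinearMap.comp_apply, sd_succ_single, bd_single, bd_cone, ih hl', bd_bdList,
      map_zero, add_zero]

lemma sd_length (n : ℕ) (l : List E) (hl : l.length = n) :
    sd n (Finsupp.single l 1) ∈ Finsupp.supported (ZMod 2) (ZMod 2)
      {l' : List E | l'.length = n} := by
  induction n generalizing l with
  | zero => rw [sd_zero]; exact Finsupp.single_mem_supported _ _ hl
  | succ n ih =>
    rw [sd_succ_single]
    refine cone_mem_supported (s := {l' | l'.length = n}) (fun l' h => by simpa using h) ?_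
    refine mem_of_supported (fun l' h => ih l' ?_) (bdList_mem_supported l)
    have h1 := h.2
    omega

lemma bary_mem {K : Set E} (hK : Convex ℝ K) {l : List E} (h0 : l ≠ [])
    (h : ∀ v ∈ l, v ∈ K) : bary l ∈ K := by
  have hpos : (0 : ℝ) < l.length := by exact_mod_cast List.length_pos_iff.2 h0
  have : bary l = ∑ i : Fin l.length, (l.length : ℝ)⁻¹ • l[i] := by
    rw [← Finset.smul_sum]
    exact congrArg _ (Fin.sum_univ_getElem l).symm
  rw [this]
  refine hK.sum_mem (fun _ _ => by positivity) ?_ (fun i _ => h _ (List.getElem_mem _))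
  simp [hpos.ne']

lemma sd_mem_convex {K : Set E} (hK : Convex ℝ K) (n : ℕ) (l : List E) (hl : l.length = n)
    (h : ∀ v ∈ l, v ∈ K) :
    sd n (Finsupp.single l 1) ∈ Finsupp.supported (ZMod 2) (ZMod 2)
      {l' : List E | ∀ v ∈ l', v ∈ K} := by
  induction n generalizing l with
  | zero => rw [sd_zero]; exact Finsupp.single_mem_supported _ _ h
  | succ n ih =>
    have h0 : l ≠ [] := by rintro rfl; simp at hl
    rw [sd_succ_single]
    refine cone_mem_supported (s := {l' | ∀ v ∈ l', v ∈ K}) (fun l' h' => ?_) ?_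
    · simpa using ⟨bary_mem hK h0 h, h'⟩
    · refine mem_of_supported (fun l' h' => ih l' ?_ ?_) (bdList_mem_supported l)
      · have h1 := h'.2
        omega
      · exact fun v hv => h v (h'.1.subset hv)

lemma dist_bary_le {l : List E} {D : ℝ} (h : ∀ v ∈ l, ∀ w ∈ l, dist v w ≤ D)
    {v : E} (hv : v ∈ l) {N : ℕ} (hN : l.length ≤ N) :
    dist v (bary l) ≤ (1 - (N : ℝ)⁻¹) * D := by
  classical
  have hD : 0 ≤ D := dist_nonneg.trans (h v hv v hv)
  have hnpos : 0 < l.length := List.length_pos_of_mem hv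
  have hpos : (0 : ℝ) < l.length := by exact_mod_cast hnpos
  have key : ∀ l' : List E, (∀ w ∈ l', dist w v ≤ D) →
      ‖l'.sum - (l'.length : ℝ) • v‖ ≤ l'.length * D := by
    intro l' h'
    induction l' with
    | nil => simp
    | cons w l' ih =>
      have h1 := ih fun u hu => h' u (by simp [hu])
      have h2 := h' w (by simp)
      rw [dist_eq_norm] at h2
      have h3 : (w :: l').sum - ((w :: l').length : ℝ) • v
          = (w - v) + (l'.sum - (l'.length : ℝ) • v) := by
        simp only [List.sum_cons, List.length_cons, Nat.cast_add, Nat.cast_one]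
        module
      rw [h3]
      refine (norm_add_le _ _).trans ?_
      simp only [List.length_cons, Nat.cast_add, Nat.cast_one]
      linarith
  have hperm : l.Perm (v :: l.erase v) := List.perm_cons_erase hv
  have hlen : (l.length : ℝ) = (l.erase v).length + 1 := by
    have := hperm.length_eq
    simp only [List.length_cons] at this
    exact_mod_cast this
  have h1 := key (l.erase v) fun w hw => h w (List.mem_of_mem_erase hw) v hv
  have h2 : bary l - v
      = (l.length : ℝ)⁻¹ • ((l.erase v).sum - ((l.erase v).length : ℝ) • v) := by
    have h3 : (l.erase v).sum - ((l.erase v).length : ℝ) • v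
        = l.sum - (l.length : ℝ) • v := by
      rw [hperm.sum_eq, List.sum_cons, hlen]
      module
    rw [h3, smul_sub, smul_smul, inv_mul_cancel₀ hpos.ne', one_smul, bary]
  rw [dist_comm, dist_eq_norm, h2, norm_smul, norm_inv, Real.norm_natCast]
  have h4 : ((l.erase v).length : ℝ) = l.length - 1 := by linarith
  rw [h4] at h1
  calc (l.length : ℝ)⁻¹ * _ ≤ (l.length : ℝ)⁻¹ * ((l.length - 1) * D) := by
        rw [h4]; gcongr
    _ = (1 - (l.length : ℝ)⁻¹) * D := by field_simp
    _ ≤ (1 - (N : ℝ)⁻¹) * D := by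
        have : (l.length : ℝ) ≤ N := by exact_mod_cast hN
        gcongr

/-- Subdividing shrinks the diameter of a simplex with at most `N` vertices by the factor
`1 - 1 / N`. -/
lemma sd_mesh {N : ℕ} {D : ℝ} (n : ℕ) (hn : n ≤ N) (l : List E) (hl : l.length = n)
    (h : ∀ v ∈ l, ∀ w ∈ l, dist v w ≤ D) :
    sd n (Finsupp.single l 1) ∈ Finsupp.supported (ZMod 2) (ZMod 2)
      {l' : List E | ∀ v ∈ l', ∀ w ∈ l', dist v w ≤ (1 - (N : ℝ)⁻¹) * D} := by
  induction n generalizing l with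
  | zero =>
    obtain rfl := List.length_eq_zero_iff.1 hl
    rw [sd_zero]
    exact Finsupp.single_mem_supported _ _ (by simp)
  | succ n ih =>
    have hr : 0 ≤ (1 - (N : ℝ)⁻¹) * D := by
      obtain ⟨v, hv⟩ := List.exists_mem_of_length_pos (l := l) (by omega)
      have h0 : 0 ≤ D := dist_nonneg.trans (h v hv v hv)
      exact mul_nonneg (sub_nonneg.2 (Nat.cast_inv_le_one N)) h0
    rw [sd_succ_single]
    -- The vertices of the subdivided boundary lie in the ball about the barycentre which
    -- contains all vertices of `l`.
    refine cone_mem_supported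
      (s := {l' | ∀ v ∈ l', ∀ w ∈ l', dist v w ≤ (1 - (N : ℝ)⁻¹) * D} ∩
        {l' | ∀ v ∈ l', v ∈ Metric.closedBall (bary l) ((1 - (N : ℝ)⁻¹) * D)}) ?_ ?_
    · rintro l' ⟨h1, h2⟩
      simp only [Metric.mem_closedBall, Set.mem_ofPred_eq] at h2
      simp only [Set.mem_ofPred_eq, List.mem_cons, forall_eq_or_imp, dist_self]
      exact ⟨⟨hr, fun v hv => by rw [dist_comm]; exact h2 v hv⟩, fun v hv => ⟨h2 v hv, h1 v hv⟩⟩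
    · refine mem_of_supported (fun l' h' => ?_) (bdList_mem_supported l)
      have h1 := h'.2
      rw [Finsupp.supported_inter]
      refine ⟨ih (by omega) l' (by omega) fun v hv w hw =>
        h v (h'.1.subset hv) w (h'.1.subset hw), ?_⟩
      refine sd_mem_convex (convex_closedBall _ _) n l' (by omega) fun v hv => ?_
      exact dist_bary_le h (h'.1.subset hv) (by omega)

end Subdivision

/-! ### The cup product of sign cochains -/

/-- The cup product of the coboundaries of the functions in `as`: on a simplex `v₀, …, vₘ` it is
the product of the factors `aᵢ vᵢ₋₁ + aᵢ vᵢ`, and it vanishes in other degrees. -/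
def cup : List (E → ZMod 2) → List E → ZMod 2
  | [], [_] => 1
  | a :: as, v :: w :: l => (a v + a w) * cup as (w :: l)
  | _, _ => 0

/-- The cup product of the `0`-cochain `a` with `cup as`. -/
def precup (a : E → ZMod 2) (as : List (E → ZMod 2)) : List E → ZMod 2
  | [] => 0
  | v :: l => a v * cup as (v :: l)

/-- The linear extension of a cochain to chains. -/
def ev (φ : List E → ZMod 2) : ListChain E →ₗ[ZMod 2] ZMod 2 :=
  Finsupp.linearCombination (ZMod 2) φ

@[simp] lemma ev_single (φ : List E → ZMod 2) (l : List E) :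
    ev φ (Finsupp.single l 1) = φ l := by
  simp [ev]

lemma ev_cone (φ : List E → ZMod 2) (v : E) (c : ListChain E) :
    ev φ (cone v c) = ev (fun l => φ (v :: l)) c :=
  hom_ext (T := ev φ ∘ₗ cone v) (U := ev fun l => φ (v :: l)) (fun l => by simp) c

lemma ev_const_mul (r : ZMod 2) (φ : List E → ZMod 2) (c : ListChain E) :
    ev (fun l => r * φ l) c = r * ev φ c :=
  hom_ext (T := ev fun l => r * φ l) (U := r • ev φ) (fun l => by simp) c

lemma ev_zero (c : ListChain E) : ev (fun _ : List E => 0) c = 0 :=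
  hom_ext (T := ev fun _ : List E => 0) (U := 0) (fun l => by simp) c

@[simp] lemma cup_nil_right (as : List (E → ZMod 2)) : cup as [] = 0 := by
  cases as <;> rfl

/-- `cup as` is a cocycle. -/
lemma ev_cup_bdList (as : List (E → ZMod 2)) (l : List E) : ev (cup as) (bdList l) = 0 := by
  induction as generalizing l with
  | nil =>
    match l with
    | [] => simp [bdList]
    | [v] => simp [bdList]
    | [v, w] => simp [bdList, cup, CharTwo.add_self_eq_zero]
    | v :: w :: u :: l => simp [bdList, cup, ev_cone, ev_zero]
  | cons a as ih =>
    match l with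
    | [] => simp [bdList]
    | [v] => simp [bdList]
    | [v, w] => simp [bdList, cup]
    | v :: w :: u :: l =>
      have h := ih (w :: u :: l)
      simp only [bdList, map_add, ev_single, ev_cone, cup, ev_const_mul] at h ⊢
      linear_combination (a v + a w) * h
        + a u * cup as (u :: l) * CharTwo.two_eq_zero (R := ZMod 2)

/-- The coboundary of `precup a as` is `cup (a :: as)`, because `cup as` is a cocycle. -/
lemma ev_precup_bdList (a : E → ZMod 2) (as : List (E → ZMod 2)) (l : List E) :
    ev (precup a as) (bdList l) = cup (a :: as) l := by
  match l with
  | [] => simp [bdList, cup]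
  | [v] => simp [bdList, cup, precup]
  | v :: w :: l =>
    have h := ev_cup_bdList as (v :: w :: l)
    simp only [bdList, map_add, ev_single, ev_cone, cup, precup, ev_const_mul] at h ⊢
    linear_combination a v * h - a v * cup as (w :: l) * CharTwo.two_eq_zero (R := ZMod 2)

lemma ev_precup_bd (a : E → ZMod 2) (as : List (E → ZMod 2)) (c : ListChain E) :
    ev (precup a as) (bd c) = ev (cup (a :: as)) c :=
  hom_ext (T := ev (precup a as) ∘ₗ bd) (U := ev (cup (a :: as)))
    (fun l => by simp [ev_precup_bdList]) c

lemma cup_map_neg [Neg E] {S : Set E} {as : List (E → ZMod 2)}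
    (has : ∀ a ∈ as, ∀ v ∈ S, a (-v) = a v + 1) {l : List E} (hl : ∀ v ∈ l, v ∈ S) :
    cup as (l.map Neg.neg) = cup as l := by
  induction as generalizing l with
  | nil =>
    match l with
    | [] => rfl
    | [v] => rfl
    | v :: w :: l => rfl
  | cons a as ih =>
    match l with
    | [] => rfl
    | [v] => rfl
    | v :: w :: l =>
      have h1 := ih (fun b hb => has b (by simp [hb])) (l := w :: l)
        (fun u hu => hl u (List.mem_cons_of_mem _ hu))
      have hv := has a (by simp) v (hl v (by simp))
      have hw := has a (by simp) w (hl w (by simp))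
      simp only [List.map_cons, cup] at h1 ⊢
      rw [h1, hv, hw]
      linear_combination cup as (w :: l) * CharTwo.two_eq_zero (R := ZMod 2)

/-- The antipodal map changes `precup a as` by `cup as`. With `∂ h (i + 1) = h i + ν (h i)` this
makes the values of the cup products on the hemispheres independent of the dimension. -/
lemma precup_map_neg [Neg E] {S : Set E} {a : E → ZMod 2} {as : List (E → ZMod 2)}
    (ha : ∀ v ∈ S, a (-v) = a v + 1) (has : ∀ a ∈ as, ∀ v ∈ S, a (-v) = a v + 1)
    {l : List E} (hl : ∀ v ∈ l, v ∈ S) :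
    precup a as (l.map Neg.neg) = precup a as l + cup as l := by
  match l with
  | [] => simp [precup]
  | v :: l =>
    have h := cup_map_neg has hl
    simp only [List.map_cons, precup] at h ⊢
    rw [h, ha v (hl v (by simp))]
    ring

lemma exists_ne_of_cup_ne_zero {as : List (E → ZMod 2)} {l : List E} (h : cup as l ≠ 0) :
    l ≠ [] ∧ ∀ a ∈ as, ∃ v ∈ l, ∃ w ∈ l, a v ≠ a w := by
  induction as generalizing l with
  | nil => exact ⟨by rintro rfl; simp at h, by simp⟩
  | cons a as ih =>
    match l with
    | [] => simp at h
    | [v] => simp [cup] at h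
    | v :: w :: l =>
      rw [cup] at h
      refine ⟨by simp, fun b hb => ?_⟩
      rcases List.mem_cons.1 hb with rfl | hb
      · refine ⟨v, by simp, w, by simp, fun he => left_ne_zero_of_mul h ?_⟩
        rw [he, CharTwo.add_self_eq_zero]
      · obtain ⟨u, hu, t, ht, hne⟩ := (ih (right_ne_zero_of_mul h)).2 b hb
        exact ⟨u, List.mem_cons_of_mem _ hu, t, List.mem_cons_of_mem _ ht, hne⟩

/-! ### Hemispherical chains -/

/-- A sequence of chains that behaves like the hemispheres of increasing dimension in a sphere:
the boundary of `h (i + 1)` is the union of `h i` and its antipodal image, and `h 0` is an odd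
number of points. -/
structure IsHemispherical [Neg E] (h : ℕ → ListChain E) : Prop where
  length : ∀ i, h i ∈ Finsupp.supported (ZMod 2) (ZMod 2) {l : List E | l.length = i + 1}
  bd_zero : bd (h 0) = Finsupp.single [] 1
  bd_succ : ∀ i, bd (h (i + 1)) = h i + map Neg.neg (h i)

/-- A cup product of coboundaries of odd functions does not vanish on hemispherical chains. -/
lemma IsHemispherical.ev_cup [Neg E] {h : ℕ → ListChain E} (hh : IsHemispherical h) {S : Set E}
    {as : List (E → ZMod 2)} (has : ∀ a ∈ as, ∀ v ∈ S, a (-v) = a v + 1)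
    (hS : ∀ i < as.length, h i ∈ Finsupp.supported (ZMod 2) (ZMod 2) {l | ∀ v ∈ l, v ∈ S}) :
    ev (cup as) (h as.length) = 1 := by
  induction as with
  | nil =>
    have h1 : ev (cup []) (h 0) = ev (fun l => if l = [] then 1 else 0) (bd (h 0)) := by
      refine eq_of_supported (T := ev (cup []))
        (U := ev (fun l => if l = [] then 1 else 0) ∘ₗ bd) (fun l hl => ?_) (hh.length 0)
      obtain ⟨v, rfl⟩ := List.length_eq_one_iff.1 hl
      simp [bdList, cup]
    rw [List.length_nil, h1, hh.bd_zero]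
    simp
  | cons a as ih =>
    have has' : ∀ a ∈ as, ∀ v ∈ S, a (-v) = a v + 1 := fun b hb => has b (by simp [hb])
    have h1 := ih has' fun i hi => hS i (by simp; omega)
    have h2 : (ev (precup a as) ∘ₗ map Neg.neg) (h as.length)
        = (ev (precup a as) + ev (cup as)) (h as.length) := by
      refine eq_of_supported (fun l hl => ?_) (hS as.length (by simp))
      simpa using precup_map_neg (has a (by simp)) has' hl
    simp only [LinearMap.comp_apply, LinearMap.add_apply] at h2
    rw [List.length_cons, ← ev_precup_bd, hh.bd_succ, map_add, h2, ← add_assoc,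
      CharTwo.add_self_eq_zero, zero_add, h1]

/-- Subdivision commutes with the boundary and with the antipodal map. -/
lemma IsHemispherical.sd [NormedAddCommGroup E] [NormedSpace ℝ E] {h : ℕ → ListChain E}
    (hh : IsHemispherical h) : IsHemispherical fun i => sd (i + 1) (h i) where
  length i := mem_of_supported (fun l hl => sd_length _ l hl) (hh.length i)
  bd_zero := by rw [bd_sd 0 (hh.length 0), hh.bd_zero, sd_zero]
  bd_succ i := by
    rw [bd_sd (i + 1) (hh.length (i + 1)), hh.bd_succ, map_add, sd_map_neg]

/-- The hemispheres of the cross-polytope with vertices `± e i`: a point, and then the cones over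
the spheres formed by two opposite hemispheres of one dimension less. -/
def hemi [Neg E] (e : ℕ → E) : ℕ → ListChain E
  | 0 => Finsupp.single [e 0] 1
  | i + 1 => cone (e (i + 1)) (hemi e i + map Neg.neg (hemi e i))

/-- The spheres formed by two opposite hemispheres are cycles. -/
lemma bd_hemi_add_map_neg [InvolutiveNeg E] (e : ℕ → E) (i : ℕ) :
    bd (hemi e i + map Neg.neg (hemi e i)) = 0 := by
  induction i with
  | zero => simp [hemi, bdList, add_self]
  | succ i ih =>
    rw [map_add, bd_map, hemi, bd_cone, ih, map_zero, add_zero, map_add,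
      map_map_of_involutive neg_involutive, add_comm (map _ _), add_self]

lemma isHemispherical_hemi [InvolutiveNeg E] (e : ℕ → E) : IsHemispherical (hemi e) where
  length i := by
    induction i with
    | zero => exact Finsupp.single_mem_supported _ _ rfl
    | succ i ih =>
      exact cone_mem_supported (fun l hl => congrArg Nat.succ hl)
        (Submodule.add_mem _ ih (map_mem_supported (fun l hl => (List.length_map _).trans hl) ih))
  bd_zero := by simp [hemi, bdList]
  bd_succ i := by
    rw [hemi, bd_cone, bd_hemi_add_map_neg, map_zero, add_zero]

end ListChain

/-! ### The Borsuk–Ulam theorem -/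

/-- The unit sphere of the `ℓ¹` norm. -/
def crossPolytope (n : ℕ) : Set (Fin n → ℝ) := {t | ∑ i, |t i| = 1}

/-- The facet of the cross-polytope in the orthant with signs `ε i = ± 1`. -/
def facet {n : ℕ} (ε : Fin n → ℝ) : Set (Fin n → ℝ) :=
  {t | (∀ i, 0 ≤ ε i * t i) ∧ ∑ i, ε i * t i = 1}

lemma convex_facet {n : ℕ} (ε : Fin n → ℝ) : Convex ℝ (facet ε) := by
  rintro x ⟨hx, hx'⟩ y ⟨hy, hy'⟩ a b ha hb hab
  refine ⟨fun i => ?_, ?_⟩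
  · have h1 := mul_nonneg ha (hx i)
    have h2 := mul_nonneg hb (hy i)
    simp only [Pi.add_apply, Pi.smul_apply, smul_eq_mul]
    linarith
  · have : ∀ i, ε i * (a • x + b • y) i = a * (ε i * x i) + b * (ε i * y i) := fun i => by
      simp only [Pi.add_apply, Pi.smul_apply, smul_eq_mul]
      ring
    simp only [this, Finset.sum_add_distrib, ← Finset.mul_sum, hx', hy', mul_one, hab]

lemma facet_subset_crossPolytope {n : ℕ} {ε : Fin n → ℝ} (hε : ∀ i, |ε i| = 1) :
    facet ε ⊆ crossPolytope n := by
  rintro t ⟨h1, h2⟩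
  rw [crossPolytope, Set.mem_ofPred_eq, ← h2]
  refine Finset.sum_congr rfl fun i _ => ?_
  rw [← abs_of_nonneg (h1 i), abs_mul, hε i, one_mul]

lemma abs_le_one_of_mem_crossPolytope {n : ℕ} {t : Fin n → ℝ} (ht : t ∈ crossPolytope n)
    (i : Fin n) : |t i| ≤ 1 :=
  (Finset.single_le_sum (f := fun i => |t i|) (fun _ _ => abs_nonneg _)
    (Finset.mem_univ i)).trans ht.le

lemma dist_le_two_of_mem_crossPolytope {n : ℕ} {s t : Fin n → ℝ} (hs : s ∈ crossPolytope n)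
    (ht : t ∈ crossPolytope n) : dist s t ≤ 2 := by
  refine (dist_pi_le_iff (by norm_num)).2 fun i => ?_
  rw [Real.dist_eq]
  have h1 := abs_sub (s i) (t i)
  have h2 := abs_le_one_of_mem_crossPolytope hs i
  have h3 := abs_le_one_of_mem_crossPolytope ht i
  linarith

lemma isCompact_crossPolytope (n : ℕ) : IsCompact (crossPolytope n) := by
  refine Metric.isCompact_of_isClosed_isBounded
    (isClosed_eq (by fun_prop) continuous_const) ?_
  exact Metric.isBounded_iff.2 ⟨2, fun s hs t ht => dist_le_two_of_mem_crossPolytope hs ht⟩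

lemma neg_mem_crossPolytope {n : ℕ} {t : Fin n → ℝ} (ht : t ∈ crossPolytope n) :
    -t ∈ crossPolytope n := by
  simpa [crossPolytope] using ht

/-- The `i`-th standard basis vector, or `0` if there is none. -/
def stdVec (n i : ℕ) : Fin n → ℝ := fun j => if (j : ℕ) = i then 1 else 0

lemma sum_stdVec {n i : ℕ} (hi : i < n) : ∑ j, stdVec n i j = 1 := by
  rw [Finset.sum_eq_single ⟨i, hi⟩]
  · simp [stdVec]
  · intro j _ hj
    simp only [stdVec, ite_eq_right_iff, one_ne_zero, imp_false]
    exact fun h => hj (Fin.ext h)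
  · simp

lemma crossPolytope_nonempty {n : ℕ} (hn : 0 < n) : (crossPolytope n).Nonempty := by
  refine ⟨stdVec n 0, ?_⟩
  rw [crossPolytope, Set.mem_ofPred_eq, ← sum_stdVec hn]
  refine Finset.sum_congr rfl fun j _ => abs_of_nonneg ?_
  simp only [stdVec]; split_ifs <;> simp

open ListChain in
lemma hemi_stdVec_mem {n i : ℕ} (hi : i < n) :
    hemi (stdVec n) i ∈ Finsupp.supported (ZMod 2) (ZMod 2)
      {l | ∃ ε : Fin n → ℝ, (∀ j, |ε j| = 1) ∧
        ∀ t ∈ l, t ∈ facet ε ∧ ∀ j : Fin n, i < j → t j = 0} := by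
  induction i with
  | zero =>
    refine Finsupp.single_mem_supported _ _ ⟨fun _ => 1, by simp, ?_⟩
    simp only [List.mem_singleton, forall_eq]
    refine ⟨⟨fun j => ?_, by simpa using sum_stdVec hi⟩, fun j hj => ?_⟩
    · simp only [stdVec]; split_ifs <;> simp
    · simp [stdVec, hj.ne']
  | succ i ih =>
    have h := ih (by omega)
    refine cone_mem_supported ?_ (Submodule.add_mem _ h (map_mem_supported ?_ h))
    · rintro l ⟨ε, hε, hl⟩
      -- The coordinate `i + 1` vanishes on `l`, so the sign of the facet there is free.
      refine ⟨Function.update ε ⟨i + 1, hi⟩ 1, fun j => ?_, fun t ht => ?_⟩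
      · rcases eq_or_ne j ⟨i + 1, hi⟩ with rfl | hj
        · simp
        · simp [Function.update_of_ne hj, hε]
      · rcases List.mem_cons.1 ht with rfl | ht
        · have : ∀ j, Function.update ε ⟨i + 1, hi⟩ 1 j * stdVec n (i + 1) j
              = stdVec n (i + 1) j := fun j => by
            rcases eq_or_ne j ⟨i + 1, hi⟩ with rfl | hj
            · simp
            · have : (j : ℕ) ≠ i + 1 := fun h => hj (Fin.ext h)
              simp [stdVec, this]
          refine ⟨⟨fun j => ?_, ?_⟩, fun j hj => ?_⟩
          · rw [this, stdVec]; split_ifs <;> simp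
          · simp only [this, sum_stdVec hi]
          · simp [stdVec, hj.ne']
        · obtain ⟨⟨h1, h2⟩, h3⟩ := hl t ht
          have : ∀ j, Function.update ε ⟨i + 1, hi⟩ 1 j * t j = ε j * t j := fun j => by
            rcases eq_or_ne j ⟨i + 1, hi⟩ with rfl | hj
            · simp [h3 ⟨i + 1, hi⟩ (by simp)]
            · simp [Function.update_of_ne hj]
          exact ⟨⟨fun j => by rw [this]; exact h1 j, by simpa only [this] using h2⟩,
            fun j hj => h3 j (by omega)⟩
    · rintro l ⟨ε, hε, hl⟩
      refine ⟨-ε, by simpa using hε, fun t ht => ?_⟩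
      obtain ⟨u, hu, rfl⟩ := List.mem_map.1 ht
      obtain ⟨⟨h1, h2⟩, h3⟩ := hl u hu
      exact ⟨⟨by simpa using h1, by simpa using h2⟩, fun j hj => by simp [h3 j hj]⟩

open ListChain in
/-- Iterated subdivision of the hemispheres of the cross-polytope. -/
lemma exists_isHemispherical (n r : ℕ) : ∃ h : ℕ → ListChain (Fin n → ℝ), IsHemispherical h ∧
    ∀ i < n, h i ∈ Finsupp.supported (ZMod 2) (ZMod 2)
      {l | (∃ ε : Fin n → ℝ, (∀ j, |ε j| = 1) ∧ ∀ t ∈ l, t ∈ facet ε) ∧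
        ∀ s ∈ l, ∀ t ∈ l, dist s t ≤ (1 - (n : ℝ)⁻¹) ^ r * 2} := by
  induction r with
  | zero =>
    refine ⟨hemi (stdVec n), isHemispherical_hemi _, fun i hi => ?_⟩
    refine Finsupp.supported_mono ?_ (hemi_stdVec_mem hi)
    rintro l ⟨ε, hε, hl⟩
    refine ⟨⟨ε, hε, fun t ht => (hl t ht).1⟩, fun s hs t ht => ?_⟩
    rw [pow_zero, one_mul]
    exact dist_le_two_of_mem_crossPolytope (facet_subset_crossPolytope hε (hl s hs).1)
      (facet_subset_crossPolytope hε (hl t ht).1)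
  | succ r ih =>
    obtain ⟨h, hh, hs⟩ := ih
    refine ⟨_, hh.sd, fun i hi => ?_⟩
    have hs' := (Finsupp.supported_inter (R := ZMod 2) (M := ZMod 2) _ _).ge
      ⟨hs i hi, hh.length i⟩
    refine mem_of_supported ?_ hs'
    rintro l ⟨⟨⟨ε, hε, hl⟩, hd⟩, hlen⟩
    have h1 := sd_mem_convex (convex_facet ε) (i + 1) l hlen hl
    have h2 := sd_mesh (N := n) (i + 1) (by omega) l hlen hd
    refine Finsupp.supported_mono ?_
      ((Finsupp.supported_inter (R := ZMod 2) (M := ZMod 2) _ _).ge ⟨h1, h2⟩)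
    rintro l' ⟨h3, h4⟩
    refine ⟨⟨ε, hε, h3⟩, fun s hs t ht => (h4 s hs t ht).trans_eq ?_⟩
    ring

/-- There is an indicator of the vectors whose `j`-th coordinate is positive that is odd also on
the vectors whose `j`-th coordinate vanishes. -/
lemma exists_odd_sign {m : ℕ} (j : Fin m) : ∃ s : (Fin m → ℝ) → ZMod 2,
    (∀ y ≠ 0, s (-y) = s y + 1) ∧ ∀ y z, s y ≠ s z → y j * z j ≤ 0 := by
  classical
  -- Ties are broken by the lexicographic order.
  let o : (Fin m → ℝ) → ZMod 2 := fun y => if 0 < toLex y then 1 else 0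
  refine ⟨fun y => if 0 < y j then 1 else if y j < 0 then 0 else o y, fun y hy => ?_,
    fun y z hne => ?_⟩
  · rcases lt_trichotomy (y j) 0 with h | h | h
    · simp [h, h.not_gt]
    · have hy' : toLex y ≠ 0 := hy
      have ho : o (-y) = o y + 1 := by
        rcases lt_or_gt_of_ne hy' with h' | h'
        · have h1 : o (-y) = 1 := if_pos (neg_pos.2 h')
          have h2 : o y = 0 := if_neg h'.not_gt
          rw [h1, h2, zero_add]
        · have h1 : o (-y) = 0 := if_neg (neg_neg_of_pos h').not_gt
          have h2 : o y = 1 := if_pos h'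
          rw [h1, h2, CharTwo.add_self_eq_zero]
      simp [h, ho]
    · simp [h, h.not_gt, CharTwo.add_self_eq_zero]
  · by_contra! h
    rcases pos_and_pos_or_neg_and_neg_of_mul_pos h with ⟨h1, h2⟩ | ⟨h1, h2⟩
    · simp [h1, h2] at hne
    · simp [h1, h2, h1.not_gt, h2.not_gt] at hne

open ListChain in
/-- The Borsuk–Ulam theorem on the boundary of the cross-polytope. -/
theorem exists_eq_zero_of_odd {m n : ℕ} (hmn : m < n) {f : (Fin n → ℝ) → (Fin m → ℝ)}
    (hf : ContinuousOn f (crossPolytope n)) (hodd : ∀ t ∈ crossPolytope n, f (-t) = -f t) :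
    ∃ t ∈ crossPolytope n, f t = 0 := by
  by_contra! hne
  have hn : 0 < n := by omega
  obtain ⟨t₀, ht₀, hmin⟩ := (isCompact_crossPolytope n).exists_isMinOn
    (crossPolytope_nonempty hn) hf.norm
  set δ := ‖f t₀‖ with hδ
  have hδ0 : 0 < δ := norm_pos_iff.2 (hne t₀ ht₀)
  obtain ⟨η, hη, hu⟩ := Metric.uniformContinuousOn_iff.1
    ((isCompact_crossPolytope n).uniformContinuousOn_of_continuous hf) δ hδ0
  obtain ⟨r, hr⟩ : ∃ r : ℕ, (1 - (n : ℝ)⁻¹) ^ r < η / 2 := by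
    refine exists_pow_lt_of_lt_one (by positivity) ?_
    have : (0 : ℝ) < (n : ℝ)⁻¹ := by positivity
    linarith
  obtain ⟨h, hh, hsupp⟩ := exists_isHemispherical n r
  choose s hs hs' using fun j : Fin m => exists_odd_sign j
  let as : List ((Fin n → ℝ) → ZMod 2) := List.ofFn fun j t => s j (f t)
  have hlen : as.length = m := List.length_ofFn
  have has : ∀ a ∈ as, ∀ t ∈ crossPolytope n, a (-t) = a t + 1 := by
    intro a ha t ht
    obtain ⟨j, rfl⟩ := (List.mem_ofFn' _ _).1 ha
    simp only [hodd t ht]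
    exact hs j _ (hne t ht)
  have hev := hh.ev_cup has fun i hi => by
    refine Finsupp.supported_mono ?_ (hsupp i (by omega))
    rintro l ⟨⟨ε, hε, hl⟩, -⟩ t ht
    exact facet_subset_crossPolytope hε (hl t ht)
  rw [hlen] at hev
  obtain ⟨l, hl, hcup⟩ : ∃ l ∈ (h m).support, cup as l ≠ 0 := by
    by_contra! h0
    rw [ev, Finsupp.linearCombination_apply, Finsupp.sum,
      Finset.sum_eq_zero fun l hl => by rw [h0 l hl, smul_zero]] at hev
    exact zero_ne_one hev
  obtain ⟨⟨ε, hε, hface⟩, hd⟩ := (Finsupp.mem_supported _ _).1 (hsupp m hmn) hl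
  obtain ⟨hnil, hchange⟩ := exists_ne_of_cup_ne_zero hcup
  obtain ⟨t, ht⟩ := List.exists_mem_of_ne_nil l hnil
  have hS : ∀ u ∈ l, u ∈ crossPolytope n := fun u hu =>
    facet_subset_crossPolytope hε (hface u hu)
  -- Every coordinate of `f` changes its sign on the small simplex `l`, so `f` is small there.
  have hlt : ‖f t‖ < δ := by
    refine (pi_norm_lt_iff hδ0).2 fun j => ?_
    obtain ⟨u, hul, w, hw, hne'⟩ := hchange _ ((List.mem_ofFn' _ _).2 ⟨j, rfl⟩)
    have hprod := hs' j _ _ hne'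
    have hclose : ∀ v ∈ l, |f t j - f v j| < δ := fun v hv => by
      have h1 := hd t ht v hv
      have h2 := hu t (hS t ht) v (hS v hv) (by linarith)
      rw [← Real.dist_eq]
      exact (dist_le_pi_dist _ _ j).trans_lt h2
    have h1 := abs_lt.1 (hclose u hul)
    have h2 := abs_lt.1 (hclose w hw)
    rw [Real.norm_eq_abs, abs_lt]
    rcases mul_nonpos_iff.1 hprod with ⟨h3, h4⟩ | ⟨h3, h4⟩
    · exact ⟨by linarith, by linarith⟩
    · exact ⟨by linarith, by linarith⟩
  exact absurd (hmin (hS t ht)) (not_le.2 hlt)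

variable {V : Type*} [Fintype V] [DecidableEq V] (G : SimpleGraph V) [DecidableRel G.Adj]

/-! ### Sums over edges and the genus -/

lemma two_mul_Iplus (x : V → ℝ) :
    2 * Iplus G x = ∑ v, ∑ j, if G.Adj v j then |x v + x j| else 0 := by
  have h1 : ∑ v, ∑ j, (if G.Adj v j then |x v + x j| else 0)
      = ∑ d : G.Dart, |x d.fst + x d.snd| := by
    rw [← Fintype.sum_prod_type' (f := fun v j => if G.Adj v j then |x v + x j| else 0),
      ← Finset.sum_filter]
    refine (Finset.sum_bij (fun d _ => d.toProd) (fun d _ => ?_) (fun a _ b _ h => ?_)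
      (fun p hp => ?_) (fun d _ => rfl)).symm
    · simp [d.adj]
    · exact SimpleGraph.Dart.ext _ _ h
    · exact ⟨⟨p, by simpa using hp⟩, by simp, rfl⟩
  rw [h1, Iplus, Finset.mul_sum,
    ← Finset.sum_fiberwise_of_maps_to (s := Finset.univ) (t := G.edgeFinset)
      (g := SimpleGraph.Dart.edge) (fun d _ => by simp)]
  refine Finset.sum_congr rfl fun e he => ?_
  have h2 := G.dart_edge_fiber_card e (by simpa using he)
  rw [Finset.sum_congr rfl (g := fun _ => Sym2.lift ⟨fun i j => |x i + x j|,
    fun i j => congrArg _ (add_comm (x i) (x j))⟩ e), Finset.sum_const, h2, nsmul_eq_mul,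
    Nat.cast_ofNat]
  intro d hd
  rw [← (Finset.mem_filter.1 hd).2]
  rfl

lemma Iplus_nonneg (x : V → ℝ) : 0 ≤ Iplus G x := by
  have h := two_mul_Iplus G x
  have : 0 ≤ ∑ v, ∑ j, if G.Adj v j then |x v + x j| else 0 :=
    Finset.sum_nonneg fun v _ => Finset.sum_nonneg fun j _ => by split_ifs <;> positivity
  linarith

omit [Fintype V] [DecidableEq V] in
lemma card_interedges_eq_sum (A B : Finset V) :
    ((G.interedges A B).card : ℝ)
      = ∑ v ∈ A, ∑ j ∈ B, if G.Adj v j then (1 : ℝ) else 0 := by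
  rw [SimpleGraph.interedges, Rel.interedges, Finset.card_filter, Nat.cast_sum,
    Finset.sum_product]
  simp

omit [DecidableEq V] in
lemma sum_adj_left (g : V → ℝ) :
    ∑ v, ∑ j, (if G.Adj v j then g v else 0) = ∑ v, (G.degree v : ℝ) * g v := by
  refine Finset.sum_congr rfl fun v _ => ?_
  rw [← Finset.sum_filter, Finset.sum_const, nsmul_eq_mul, ← G.card_neighborFinset_eq_degree,
    G.neighborFinset_eq_filter]

omit [DecidableEq V] in
lemma sum_adj_right (g : V → ℝ) :
    ∑ v, ∑ j, (if G.Adj v j then g j else 0) = ∑ v, (G.degree v : ℝ) * g v := by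
  rw [Finset.sum_comm, ← sum_adj_left]
  simp only [G.adj_comm]

/-- An odd continuous image of the boundary of the `k`-dimensional cross-polytope has genus at least
`k`, by the Borsuk–Ulam theorem. -/
lemma le_genus_image {W : Type*} {k : ℕ} {L : (Fin k → ℝ) → (W → ℝ)} (hL : Continuous L)
    (hodd : ∀ t, L (-t) = -L t) : (k : ℕ∞) ≤ genus (L '' crossPolytope k) := by
  refine le_iInf₂ fun m ⟨f, hf, hfo, hf0⟩ => ?_
  by_contra! hlt
  obtain ⟨t, ht, h0⟩ := exists_eq_zero_of_odd (m := m) (n := k) (by exact_mod_cast hlt)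
    (f := f ∘ L) (hf.comp hL.continuousOn (Set.mapsTo_image _ _))
    (fun t ht => by simpa [hodd] using hfo _ (Set.mem_image_of_mem L ht))
  exact hf0 _ (Set.mem_image_of_mem L ht) h0

/-! ### Upper bound for the min-max eigenvalues -/

section Upper

variable {k : ℕ} (A B : Fin k → Finset V)

/-- The function equal to `y i` on `A i`, to `-y i` on `B i`, and to `0` elsewhere. -/
def blockFun (y : Fin k → ℝ) (v : V) : ℝ :=
  ∑ i, y i * ((if v ∈ A i then 1 else 0) - if v ∈ B i then 1 else 0)

variable {A B}

omit [Fintype V] in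
lemma blockFun_of_mem_left (hAB : ∀ i, Disjoint (A i) (B i))
    (hd : ∀ i j, i ≠ j → Disjoint (A i ∪ B i) (A j ∪ B j)) (y : Fin k → ℝ) {i : Fin k} {v : V}
    (hv : v ∈ A i) : blockFun A B y v = y i := by
  rw [blockFun, Finset.sum_eq_single i]
  · simp [hv, Finset.disjoint_left.1 (hAB i) hv]
  · intro j _ hj
    have := Finset.disjoint_left.1 (hd i j hj.symm) (Finset.mem_union_left _ hv)
    simp only [Finset.mem_union, not_or] at this
    simp [this]
  · simp

omit [Fintype V] in
lemma blockFun_of_mem_right (hAB : ∀ i, Disjoint (A i) (B i))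
    (hd : ∀ i j, i ≠ j → Disjoint (A i ∪ B i) (A j ∪ B j)) (y : Fin k → ℝ) {i : Fin k} {v : V}
    (hv : v ∈ B i) : blockFun A B y v = -y i := by
  have h := blockFun_of_mem_left (A := B) (B := A) (fun i => (hAB i).symm)
    (fun i j hij => by simpa only [Finset.union_comm] using hd i j hij) y hv
  rw [← h, blockFun, blockFun, ← Finset.sum_neg_distrib]
  exact Finset.sum_congr rfl fun i _ => by ring

omit [Fintype V] in
lemma abs_blockFun (hAB : ∀ i, Disjoint (A i) (B i))
    (hd : ∀ i j, i ≠ j → Disjoint (A i ∪ B i) (A j ∪ B j)) (y : Fin k → ℝ) (v : V) :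
    |blockFun A B y v| = ∑ i, if v ∈ A i ∪ B i then |y i| else 0 := by
  by_cases h : ∃ i, v ∈ A i ∪ B i
  · obtain ⟨i, hi⟩ := h
    rw [Finset.sum_eq_single i, if_pos hi]
    · rcases Finset.mem_union.1 hi with hv | hv
      · rw [blockFun_of_mem_left hAB hd y hv]
      · rw [blockFun_of_mem_right hAB hd y hv, abs_neg]
    · intro j _ hj
      exact if_neg (Finset.disjoint_left.1 (hd i j hj.symm) hi)
    · simp
  · push Not at h
    have h' : ∀ i, v ∉ A i ∧ v ∉ B i := fun i => by simpa using h i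
    simp [blockFun, h']

lemma degNorm_blockFun (hAB : ∀ i, Disjoint (A i) (B i))
    (hd : ∀ i j, i ≠ j → Disjoint (A i ∪ B i) (A j ∪ B j)) (y : Fin k → ℝ) :
    degNorm G (blockFun A B y) = ∑ i, |y i| * vol G (A i ∪ B i) := by
  simp only [degNorm, abs_blockFun hAB hd, Finset.mul_sum, vol]
  rw [Finset.sum_comm]
  refine Finset.sum_congr rfl fun i _ => ?_
  rw [← Finset.sum_subset (Finset.subset_univ (A i ∪ B i))]
  · exact Finset.sum_congr rfl fun v hv => by rw [if_pos hv, mul_comm]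
  · exact fun v _ hv => by rw [if_neg hv, mul_zero]

/-- The edges between `A i` and `B i` do not contribute to `I⁺` of a block function. -/
lemma Iplus_blockFun_le (hAB : ∀ i, Disjoint (A i) (B i))
    (hd : ∀ i j, i ≠ j → Disjoint (A i ∪ B i) (A j ∪ B j)) (y : Fin k → ℝ) :
    Iplus G (blockFun A B y) ≤ degNorm G (blockFun A B y)
      - ∑ i, |y i| * (2 * ((G.interedges (A i) (B i)).card : ℝ)) := by
  set x := blockFun A B y with hx
  let p : Fin k → V → V → ℝ := fun i v j =>
    (if v ∈ A i then if j ∈ B i then 1 else 0 else 0)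
      + if v ∈ B i then if j ∈ A i then 1 else 0 else 0
  have hpt : ∀ v j, |x v + x j| ≤ |x v| + |x j| - 2 * ∑ i, |y i| * p i v j := by
    intro v j
    have hsep : ∀ {i i' : Fin k} {u : V}, i ≠ i' → u ∈ A i ∪ B i → u ∉ A i' ∧ u ∉ B i' := by
      intro i i' u hne hu
      simpa using Finset.disjoint_left.1 (hd i i' hne) hu
    by_cases h : ∃ i, v ∈ A i ∧ j ∈ B i ∨ v ∈ B i ∧ j ∈ A i
    · obtain ⟨i, hi⟩ := h
      have hv : v ∈ A i ∪ B i := by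
        rcases hi with h | h <;> simp [h.1]
      have hsum : ∑ i', |y i'| * p i' v j = |y i| * p i v j := by
        refine Finset.sum_eq_single i (fun i' _ hi' => ?_) (by simp)
        have := hsep hi'.symm hv
        simp [p, this]
      rw [hsum]
      rcases hi with ⟨h1, h2⟩ | ⟨h1, h2⟩
      · have h3 := Finset.disjoint_left.1 (hAB i) h1
        simp [p, hx, blockFun_of_mem_left hAB hd y h1, blockFun_of_mem_right hAB hd y h2, h1, h2,
          h3]
        linarith
      · have h3 := Finset.disjoint_right.1 (hAB i) h1
        simp [p, hx, blockFun_of_mem_right hAB hd y h1, blockFun_of_mem_left hAB hd y h2, h1, h2,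
          h3]
        linarith
    · push Not at h
      have : ∑ i', |y i'| * p i' v j = 0 := by
        refine Finset.sum_eq_zero fun i _ => ?_
        obtain ⟨h1, h2⟩ := h i
        have : p i v j = 0 := by
          simp only [p]
          split_ifs <;> simp_all
        rw [this, mul_zero]
      rw [this]
      simpa using abs_add_le (x v) (x j)
  have hp : ∀ i, ∑ v, ∑ j, (if G.Adj v j then p i v j else 0)
      = 2 * ((G.interedges (A i) (B i)).card : ℝ) := by
    intro i
    have h1 : ∀ C D : Finset V, ((G.interedges C D).card : ℝ)
        = ∑ v, ∑ j, if G.Adj v j then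
            (if v ∈ C then if j ∈ D then (1 : ℝ) else 0 else 0) else 0 := by
      intro C D
      rw [card_interedges_eq_sum, ← Finset.sum_subset (Finset.subset_univ C)]
      · refine Finset.sum_congr rfl fun v hv => ?_
        rw [← Finset.sum_subset (Finset.subset_univ D)]
        · exact Finset.sum_congr rfl fun j hj => by simp [hv, hj]
        · exact fun j _ hj => by simp [hj]
      · exact fun v _ hv => by simp [hv]
    have := G.symm
    have h2 : (G.interedges (A i) (B i)).card = (G.interedges (B i) (A i)).card :=
      Rel.card_interedges_comm _ _
    rw [two_mul]
    nth_rewrite 2 [h2]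
    rw [h1, h1, ← Finset.sum_add_distrib]
    refine Finset.sum_congr rfl fun v _ => ?_
    rw [← Finset.sum_add_distrib]
    refine Finset.sum_congr rfl fun j _ => ?_
    split_ifs <;> simp [p, *]
  have htot : 2 * Iplus G x ≤ ∑ v, ∑ j, if G.Adj v j then
      |x v| + |x j| - 2 * ∑ i, |y i| * p i v j else 0 := by
    rw [two_mul_Iplus]
    refine Finset.sum_le_sum fun v _ => Finset.sum_le_sum fun j _ => ?_
    split_ifs
    · exact hpt v j
    · rfl
  have heq : ∑ v, ∑ j, (if G.Adj v j then
      |x v| + |x j| - 2 * ∑ i, |y i| * p i v j else 0)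
      = ∑ v, ∑ j, (if G.Adj v j then |x v| else 0) + ∑ v, ∑ j, (if G.Adj v j then |x j| else 0)
        - 2 * ∑ i, |y i| * ∑ v, ∑ j, if G.Adj v j then p i v j else 0 := by
    have h3 : ∑ i, |y i| * ∑ v, ∑ j, (if G.Adj v j then p i v j else 0)
        = ∑ v, ∑ j, if G.Adj v j then ∑ i, |y i| * p i v j else 0 := by
      simp only [Finset.mul_sum]
      rw [Finset.sum_comm]
      refine Finset.sum_congr rfl fun v _ => ?_
      rw [Finset.sum_comm]
      refine Finset.sum_congr rfl fun j _ => ?_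
      split_ifs <;> simp
    rw [h3, Finset.mul_sum, ← Finset.sum_add_distrib, ← Finset.sum_sub_distrib]
    refine Finset.sum_congr rfl fun v _ => ?_
    rw [Finset.mul_sum, ← Finset.sum_add_distrib, ← Finset.sum_sub_distrib]
    refine Finset.sum_congr rfl fun j _ => ?_
    split_ifs <;> ring
  rw [heq, sum_adj_left, sum_adj_right] at htot
  simp only [hp] at htot
  rw [degNorm]
  linarith

omit [DecidableEq V] in
lemma vol_pos (hG : ∀ v, 0 < G.degree v) {S : Finset V} (hS : S.Nonempty) : 0 < vol G S :=
  Finset.sum_pos (fun v _ => by exact_mod_cast hG v) hS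

/-- The normalized block functions of `k` pairs form a cross-polytope on which `I⁺` is at most
`1 - r`, where `r` is the least ratio of the pairs. -/
lemma minmaxEigenvalue_le_one_sub (hG : ∀ v, 0 < G.degree v) (hk : 1 ≤ k)
    (hAB : ∀ i, Disjoint (A i) (B i))
    (hd : ∀ i j, i ≠ j → Disjoint (A i ∪ B i) (A j ∪ B j)) (hne : ∀ i, (A i ∪ B i).Nonempty) :
    minmaxEigenvalue G k
      ≤ 1 - ⨅ i, 2 * ((G.interedges (A i) (B i)).card : ℝ) / vol G (A i ∪ B i) := by
  set r := ⨅ i, 2 * ((G.interedges (A i) (B i)).card : ℝ) / vol G (A i ∪ B i) with hr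
  let L : (Fin k → ℝ) → V → ℝ := fun t => blockFun A B fun i => t i / vol G (A i ∪ B i)
  have hv : ∀ i, 0 < vol G (A i ∪ B i) := fun i => vol_pos G hG (hne i)
  have hLc : Continuous L := by
    unfold L blockFun
    fun_prop
  have hLodd : ∀ t, L (-t) = -L t := fun t => by
    ext v
    simp only [L, blockFun, Pi.neg_apply, neg_div, neg_mul, Finset.sum_neg_distrib]
  have hLn : ∀ t ∈ crossPolytope k, degNorm G (L t) = 1 := fun t ht => by
    have ht : ∑ i, |t i| = 1 := ht
    rw [degNorm_blockFun G hAB hd, ← ht]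
    refine Finset.sum_congr rfl fun i _ => ?_
    rw [abs_div, abs_of_pos (hv i), div_mul_cancel₀ _ (hv i).ne']
  have hLI : ∀ t ∈ crossPolytope k, Iplus G (L t) ≤ 1 - r := fun t ht => by
    have h1 := Iplus_blockFun_le G hAB hd fun i => t i / vol G (A i ∪ B i)
    have h2 : degNorm G (blockFun A B fun i => t i / vol G (A i ∪ B i)) = 1 := hLn t ht
    have ht : ∑ i, |t i| = 1 := ht
    rw [h2] at h1
    refine h1.trans (sub_le_sub_left ?_ _)
    calc r = ∑ i, |t i| * r := by rw [← Finset.sum_mul, ht, one_mul]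
      _ ≤ _ := Finset.sum_le_sum fun i _ => ?_
    have h3 : r ≤ 2 * ((G.interedges (A i) (B i)).card : ℝ) / vol G (A i ∪ B i) :=
      ciInf_le (Set.finite_range _).bddBelow i
    rw [abs_div, abs_of_pos (hv i), div_mul_eq_mul_div, mul_div_assoc]
    gcongr
  have hle : minmaxEigenvalue G k ≤ sSup (Iplus G '' (L '' crossPolytope k)) := by
    refine csInf_le ⟨0, ?_⟩ ⟨L '' crossPolytope k, ?_, (isCompact_crossPolytope k).image hLc, ?_,
      le_genus_image hLc hLodd, rfl⟩
    · rintro _ ⟨S, -, -, -, -, rfl⟩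
      refine Real.sSup_nonneg ?_
      rintro _ ⟨x, -, rfl⟩
      exact Iplus_nonneg G x
    · rintro _ ⟨t, ht, rfl⟩
      exact hLn t ht
    · rintro _ ⟨t, ht, rfl⟩
      exact ⟨-t, neg_mem_crossPolytope ht, hLodd t⟩
  refine hle.trans (csSup_le ?_ ?_)
  · exact ((crossPolytope_nonempty hk).image _).image _
  · rintro _ ⟨_, ⟨t, ht, rfl⟩, rfl⟩
    exact hLI t ht

end Upper

lemma minmaxEigenvalue_le (hG : ∀ v, 0 < G.degree v) {k : ℕ} (hk₁ : 1 ≤ k)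
    (hk₂ : k ≤ Fintype.card V) : minmaxEigenvalue G k ≤ 1 - kwayDualCheeger G k := by
  rw [le_sub_comm]
  refine csSup_le ?_ ?_
  · obtain ⟨e⟩ : Nonempty (Fin k ↪ V) := Function.Embedding.nonempty_of_card_le (by simpa)
    refine ⟨_, fun i => {e i}, fun _ => ∅, by simp, fun i j hij => ?_, by simp, rfl⟩
    simpa using fun h => hij (e.injective h)
  · rintro _ ⟨A, B, hAB, hd, hne, rfl⟩
    rw [le_sub_comm]
    exact minmaxEigenvalue_le_one_sub G hG hk₁ hAB hd hne

/-! ### Lower bound by nodal domains -/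

lemma Sgn_of_pos {t : ℝ} (ht : 0 < t) : Sgn t = {1} := if_pos ht

lemma Sgn_of_neg {t : ℝ} (ht : t < 0) : Sgn t = {-1} := by
  rw [Sgn, if_neg ht.not_gt, if_pos ht]

/-- For an eigenpair `(c, x)` and a union `D` of nodal domains of `x`, given by the sets `A` and
`B` where `x` is positive and negative, testing the eigenvalue equation against the sign of `x`
on `D` counts the edges between `A` and `B`. -/
lemma two_mul_card_interedges_eq {c : ℝ} {x : V → ℝ} (hx : IsEigenpair G c x) {A B : Finset V}
    (hA : ∀ v ∈ A, 0 < x v) (hB : ∀ v ∈ B, x v < 0)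
    (hAB : ∀ v ∈ A ∪ B, ∀ j, G.Adj v j → x j ≠ 0 → j ∈ A ∪ B) :
    2 * ((G.interedges A B).card : ℝ) = (1 - c) * vol G (A ∪ B) := by
  obtain ⟨-, y, ⟨z, hz, hyz⟩, _, ⟨s, hs, hy'⟩, hys⟩ := hx
  have hdisj : Disjoint A B :=
    Finset.disjoint_left.2 fun v h1 h2 => lt_asymm (hA v h1) (hB v h2)
  have heq : ∀ v, ∑ j ∈ G.neighborFinset v, z v j = c * ((G.degree v : ℝ) * s v) := fun v => by
    rw [← hyz, hys, Pi.smul_apply, smul_eq_mul, hy']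
  -- The edges from a vertex of `A` along which `z` is not `1` end in `B`.
  have h1 : ∀ v ∈ A, ∑ j ∈ B, (if G.Adj v j then 1 - z v j else 0) = (1 - c) * G.degree v := by
    intro v hv
    have hs1 : s v = 1 := by
      have := hs v
      rwa [Sgn_of_pos (hA v hv)] at this
    have h2 : ∑ j ∈ G.neighborFinset v, (1 - z v j) = (1 - c) * G.degree v := by
      rw [Finset.sum_sub_distrib, heq, hs1, Finset.sum_const, nsmul_eq_mul,
        G.card_neighborFinset_eq_degree]
      ring
    rw [← h2, G.neighborFinset_eq_filter, Finset.sum_filter]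
    refine Finset.sum_subset (Finset.subset_univ _) fun j _ hj => ?_
    refine ite_eq_right_iff.2 fun hadj => ?_
    have hnn : 0 ≤ x j := by
      by_contra! hlt
      rcases Finset.mem_union.1 (hAB v (Finset.mem_union_left _ hv) j hadj hlt.ne) with h | h
      · exact lt_asymm hlt (hA j h)
      · exact hj h
    have := (hz v j hadj).1
    rw [Sgn_of_pos (by linarith [hA v hv])] at this
    rw [Set.mem_singleton_iff.1 this, sub_self]
  have h2 : ∀ v ∈ B, ∑ j ∈ A, (if G.Adj v j then 1 + z v j else 0) = (1 - c) * G.degree v := by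
    intro v hv
    have hs1 : s v = -1 := by
      have := hs v
      rwa [Sgn_of_neg (hB v hv)] at this
    have h2 : ∑ j ∈ G.neighborFinset v, (1 + z v j) = (1 - c) * G.degree v := by
      rw [Finset.sum_add_distrib, heq, hs1, Finset.sum_const, nsmul_eq_mul,
        G.card_neighborFinset_eq_degree]
      ring
    rw [← h2, G.neighborFinset_eq_filter, Finset.sum_filter]
    refine Finset.sum_subset (Finset.subset_univ _) fun j _ hj => ?_
    refine ite_eq_right_iff.2 fun hadj => ?_
    have hnn : x j ≤ 0 := by
      by_contra! hlt
      rcases Finset.mem_union.1 (hAB v (Finset.mem_union_right _ hv) j hadj hlt.ne') with h | h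
      · exact hj h
      · exact lt_asymm hlt (hB j h)
    have := (hz v j hadj).1
    rw [Sgn_of_neg (by linarith [hB v hv])] at this
    rw [Set.mem_singleton_iff.1 this, add_neg_cancel]
  have h3 : (1 - c) * vol G (A ∪ B) = ∑ v ∈ A, ∑ j ∈ B, (if G.Adj v j then 1 - z v j else 0)
      + ∑ v ∈ B, ∑ j ∈ A, (if G.Adj v j then 1 + z v j else 0) := by
    rw [Finset.sum_congr rfl h1, Finset.sum_congr rfl h2, vol, Finset.sum_union hdisj, mul_add,
      Finset.mul_sum, Finset.mul_sum]
  rw [h3, Finset.sum_comm (s := B), ← Finset.sum_add_distrib, card_interedges_eq_sum,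
    Finset.mul_sum]
  refine Finset.sum_congr rfl fun v _ => ?_
  rw [← Finset.sum_add_distrib, Finset.mul_sum]
  refine Finset.sum_congr rfl fun j _ => ?_
  by_cases hadj : G.Adj v j
  · rw [if_pos hadj, if_pos hadj, if_pos hadj.symm, (hz v j hadj).2]
    ring
  · rw [if_neg hadj, if_neg hadj, if_neg fun h => hadj h.symm]
    ring

lemma bddAbove_kwayDualCheeger (k : ℕ) : BddAbove {r | ∃ A B : Fin k → Finset V,
    (∀ i, Disjoint (A i) (B i)) ∧
    (∀ i j, i ≠ j → Disjoint (A i ∪ B i) (A j ∪ B j)) ∧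
    (∀ i, (A i ∪ B i).Nonempty) ∧
    r = ⨅ i, 2 * ((G.interedges (A i) (B i)).card : ℝ) / vol G (A i ∪ B i)} := by
  refine ((Set.finite_range fun p : (Fin k → Finset V) × (Fin k → Finset V) =>
    ⨅ i, 2 * ((G.interedges (p.1 i) (p.2 i)).card : ℝ) / vol G (p.1 i ∪ p.2 i)).subset ?_).bddAbove
  rintro _ ⟨A, B, -, -, -, rfl⟩
  exact ⟨(A, B), rfl⟩

/-- Every nodal domain of an eigenvector, split by the sign of the eigenvector, has the same ratio
`1 - c`, so the nodal domains are a competitor for the dual Cheeger constant. -/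
lemma one_sub_kwayDualCheeger_le (hG : ∀ v, 0 < G.degree v) {c : ℝ} {x : V → ℝ}
    (hx : IsEigenpair G c x) : 1 - kwayDualCheeger G (numNodalDomains G x) ≤ c := by
  classical
  set H := G.induce {i | x i ≠ 0} with hH
  obtain ⟨e⟩ : Nonempty (Fin (numNodalDomains G x) ≃ H.ConnectedComponent) :=
    ⟨(Finite.equivFin _).symm⟩
  let D : Fin (numNodalDomains G x) → Finset V := fun i =>
    Finset.univ.filter fun v => ∃ h : x v ≠ 0, H.connectedComponentMk ⟨v, h⟩ = e i
  let A := fun i => (D i).filter fun v => 0 < x v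
  let B := fun i => (D i).filter fun v => x v < 0
  have hD : ∀ i v, v ∈ D i ↔ ∃ h : x v ≠ 0, H.connectedComponentMk ⟨v, h⟩ = e i := by simp [D]
  have hunion : ∀ i, A i ∪ B i = D i := fun i => by
    ext v
    simp only [A, B, Finset.mem_union, Finset.mem_filter, ← and_or_left, and_iff_left_iff_imp]
    exact fun hv => (lt_or_gt_of_ne ((hD i v).1 hv).1).symm
  have hdisj : ∀ i j, i ≠ j → Disjoint (D i) (D j) := fun i j hij => by
    refine Finset.disjoint_left.2 fun v h1 h2 => hij (e.injective ?_)
    obtain ⟨_, h1⟩ := (hD i v).1 h1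
    obtain ⟨_, h2⟩ := (hD j v).1 h2
    rw [← h1, h2]
  have hne : ∀ i, (D i).Nonempty := fun i => by
    obtain ⟨⟨v, hv⟩, h⟩ := (e i).exists_rep
    exact ⟨v, (hD i v).2 ⟨hv, h⟩⟩
  have hratio : ∀ i, 2 * ((G.interedges (A i) (B i)).card : ℝ) / vol G (A i ∪ B i) = 1 - c := by
    intro i
    have hv := vol_pos G hG (hne i)
    rw [two_mul_card_interedges_eq G hx (fun v hv => (Finset.mem_filter.1 hv).2)
      (fun v hv => (Finset.mem_filter.1 hv).2), hunion, mul_div_cancel_right₀ _ hv.ne']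
    intro v hv j hadj hj
    rw [hunion] at hv ⊢
    obtain ⟨h1, h2⟩ := (hD i v).1 hv
    refine (hD i j).2 ⟨hj, ?_⟩
    rw [← h2]
    exact SimpleGraph.ConnectedComponent.sound
      (SimpleGraph.Adj.reachable (G := H) (u := ⟨j, hj⟩) (v := ⟨v, h1⟩) hadj.symm)
  have : Nonempty (Fin (numNodalDomains G x)) := by
    obtain ⟨v, hv⟩ := Function.ne_iff.1 hx.1
    exact ⟨e.symm (H.connectedComponentMk ⟨v, hv⟩)⟩
  rw [sub_le_comm]
  refine le_csSup (bddAbove_kwayDualCheeger G _) ⟨A, B, fun i => ?_, fun i j hij => ?_,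
    fun i => ?_, ?_⟩
  · exact Finset.disjoint_left.2 fun v h1 h2 =>
      lt_asymm (Finset.mem_filter.1 h1).2 (Finset.mem_filter.1 h2).2
  · rw [hunion, hunion]; exact hdisj i j hij
  · rw [hunion]; exact hne i
  · simp only [hratio, ciInf_const]

end

end DualCheeger

theorem mainTheorem2 {V : Type*} [Fintype V] [DecidableEq V]
    (G : SimpleGraph V) [DecidableRel G.Adj] (hG : ∀ v, 0 < G.degree v)
    (k : ℕ) (hk₁ : 1 ≤ k) (hk₂ : k ≤ Fintype.card V)
    (x : V → ℝ) (hx : DualCheeger.IsEigenpair G (DualCheeger.minmaxEigenvalue G k) x) :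
    1 - DualCheeger.kwayDualCheeger G (DualCheeger.numNodalDomains G x)
        ≤ DualCheeger.minmaxEigenvalue G k ∧
      DualCheeger.minmaxEigenvalue G k ≤ 1 - DualCheeger.kwayDualCheeger G k :=
  ⟨DualCheeger.one_sub_kwayDualCheeger_le G hG hx, DualCheeger.minmaxEigenvalue_le G hG hk₁ hk₂⟩
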